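/- All graphs are finite and simple. Write $H\prec G$ if $H$ is isomorphic to an induced subgraph of $G$. For a family $\mathcal H$ of graphs, $G$ is $\mathcal H$-free if no $H\in\mathcal H$ satisfies $H\prec G$; for two families, $\mathcal H_1\le\mathcal H_2$ means that for every $H_2\in\mathcal H_2$ there is $H_1\in\mathcal H_1$ with $H_1\prec H_2$. For a vertex $v$ of a graph $G$ let $IS(v)=\max\{|S| : S \text{ is an independent set of } G \text{ with } v\in S\}$, and let $IS(G)=\min\{IS(v): v\in V(G)\}$ be the independence saturation number of $G$. Let $B\text{-}IS$ be the collection of all (finite or infinite) families $\mathcal H$ for which there is a constant $c$ such that $IS(G)<c$ for every connected $\mathcal H$-free graph $G$. Let $K_{1,n}^*$ be obtained from the star $K_{1,n}$ by attaching one pendant vertex to each leaf, let $K_n^*$ be obtained from the complete graph $K_n$ by attaching one pendant vertex to each vertex, let $P_n$ be the path on $n$ vertices, let $K_{n,n}$ be the complete bipartite graph with both parts of size $n$, and for $p\ge 2$ let $BS_n^p$ be obtained from a path on $p$ vertices by attaching $n$ new leaves to each of its two end vertices. **Theorem.** For every family $\mathcal H$ of graphs, $\mathcal H\in B\text{-}IS$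 if and only if $$\mathcal H\le\{K_{1,n}^*,\ K_n^*,\ P_n,\ K_{n,n}\}\cup\{BS_n^p : 2\le p\le n-3\}\quad\text{for some integer } n\ge 5.$$ -/

import Mathlib

universe u v

namespace GraphFamily

/-- A finite simple graph. -/
structure FinGraph where
  /-- the vertex type -/
  V : Type u
  [finite : Finite V]
  /-- the graph on it -/
  graph : SimpleGraph V

attribute [instance] FinGraph.finite

/-- `G` is `ℋ`-free: no member of `ℋ` is isomorphic to an induced subgraph of `G`. -/
def IsFree (ℋ : Set FinGraph.{u}) (G : FinGraph.{v}) : Prop :=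
  ∀ H ∈ ℋ, ¬ H.graph.IsIndContained G.graph

/-- `ℋ₁ ≤ ℋ₂`: every member of `ℋ₂` has an induced subgraph isomorphic to a member of `ℋ₁`. -/
def FamilyLE (ℋ₁ : Set FinGraph.{u}) (ℋ₂ : Set FinGraph.{v}) : Prop :=
  ∀ H₂ ∈ ℋ₂, ∃ H₁ ∈ ℋ₁, H₁.graph.IsIndContained H₂.graph

/-- `B-μ`: the families `ℋ` such that `μ` is bounded on the connected `ℋ`-free graphs. -/
def BoundedFamilies (μ : FinGraph.{u} → ℕ) : Set (Set FinGraph.{u}) :=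
  {ℋ | ∃ c : ℕ, ∀ G : FinGraph.{u}, G.graph.Connected → IsFree ℋ G → μ G < c}

/-- `IS(x)`: the largest size of an independent set containing the vertex `x`. -/
noncomputable def vertexIS (G : FinGraph.{u}) (x : G.V) : ℕ :=
  sSup {k | ∃ S : Finset G.V, G.graph.IsIndepSet (S : Set G.V) ∧ x ∈ S ∧ S.card = k}

/-- The independence saturation number `IS(G)`: the minimum of `IS(x)` over the vertices `x`. -/
noncomputable def independenceSaturation (G : FinGraph.{u}) : ℕ :=
  ⨅ x : G.V, vertexIS G x

/-- The graph obtained from `G` by attaching one new pendant vertex to every vertex in `S`. -/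
def addPendants {V : Type u} (G : SimpleGraph V) (S : Set V) : SimpleGraph (V ⊕ S) where
  Adj
    | .inl a, .inl b => G.Adj a b
    | .inl a, .inr s => a = s
    | .inr s, .inl a => a = s
    | .inr _, .inr _ => False
  symm := ⟨by
    rintro (a | a) (b | b) h
    · exact h.symm
    · exact h
    · exact h
    · exact h⟩
  loopless := ⟨by
    rintro (a | a) h
    · exact G.loopless.irrefl a h
    · exact h⟩

/-- `K_{1,n}^*`: a pendant vertex is attached to every leaf of the star `K_{1,n}`. -/
def starPendant (n : ℕ) : FinGraph.{0} where
  V := (Fin 1 ⊕ Fin n) ⊕ (Set.range (Sum.inr : Fin n → Fin 1 ⊕ Fin n))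
  graph := addPendants (completeBipartiteGraph (Fin 1) (Fin n)) (Set.range Sum.inr)

/-- `K_n^*`: a pendant vertex is attached to every vertex of `K_n`. -/
def completePendant (n : ℕ) : FinGraph.{0} where
  V := Fin n ⊕ (Set.univ : Set (Fin n))
  graph := addPendants (⊤ : SimpleGraph (Fin n)) Set.univ

/-- `P_n`: the path with `n` vertices. -/
def path (n : ℕ) : FinGraph.{0} where
  V := Fin n
  graph := SimpleGraph.pathGraph n

/-- `K_{n,n}`. -/
def completeBipartite (n : ℕ) : FinGraph.{0} where
  V := Fin n ⊕ Fin n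
  graph := completeBipartiteGraph (Fin n) (Fin n)

/-- The bistar `BS_n^p` (for `p ≥ 2`): a path on `p` vertices `0, …, p - 1`, with `n` leaves
attached to the end `0` (labelled `false`) and `n` leaves attached to the end `p - 1`
(labelled `true`). -/
def bistarGraph (n p : ℕ) : SimpleGraph (Fin p ⊕ (Bool × Fin n)) where
  Adj
    | .inl a, .inl b => (SimpleGraph.pathGraph p).Adj a b
    | .inl a, .inr (e, _) => if e then (a : ℕ) + 1 = p else (a : ℕ) = 0
    | .inr (e, _), .inl a => if e then (a : ℕ) + 1 = p else (a : ℕ) = 0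
    | .inr _, .inr _ => False
  symm := ⟨by
    rintro (a | a) (b | b) h
    · exact SimpleGraph.Adj.symm h
    · exact h
    · exact h
    · exact h⟩
  loopless := ⟨by
    rintro (a | a) h
    · exact (SimpleGraph.pathGraph p).loopless.irrefl a h
    · exact h⟩

/-- `BS_n^p` as a finite graph. -/
def bistar (n p : ℕ) : FinGraph.{0} where
  V := Fin p ⊕ (Bool × Fin n)
  graph := bistarGraph n p

/-- `{K_{1,n}^*, K_n^*, P_n, K_{n,n}, BS_n^p : 2 ≤ p ≤ n - 3}`. -/
def saturationFamily (n : ℕ) : Set FinGraph.{0} :=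
  {starPendant n, completePendant n, path n, completeBipartite n} ∪
    {H | ∃ p : ℕ, 2 ≤ p ∧ p + 3 ≤ n ∧ H = bistar n p}

end GraphFamily

/-!
Necessity: the members of `saturationFamily n` are connected, and each of their vertices lies in an
independent set whose size tends to infinity with `n`
(`connected_and_hasIndependentFamilies`). If the independence saturation number of all connected
`ℋ`-free graphs is below `c`, then no member of `saturationFamily (2 * c + 5)` is `ℋ`-free.

Sufficiency: induced containment is transitive, so it is enough to treat a connected graph `G`
containing no member of `saturationFamily n` (`exists_vertex_indepSet_card_lt`). Suppose that all
vertices of `G` lie in huge independent sets. Without `P_n`, `K_n^*` and `K_{1,n}^*`, every huge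
independent set has many elements with a common neighbour, and the common neighbour can be taken one
step closer to any prescribed root (`exists_common_neighbour`). In particular `G` has large
induced stars; let `x` be the centre of a largest one, with leaf set `L`, and let `S` be a huge
independent set containing `x`. Excluding `K_{n,n}`, `BS_n^2` and `K_{1,n}^*`, only boundedly many
elements of `S` have a neighbour in `L` (`card_filter_exists_adj_le`). Among the remaining ones there
is a large set `M` with a common neighbour `y`, where `M` lies one step further from `x` than `y`
does. As the star at `x` is largest, `y` is nonadjacent to many vertices of `L`. The two stars thus
obtained, at `x` and at `y`, have mutually nonadjacent leaf sets, and a geodesic from `x` to `y`,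
trimmed so that only its first vertex is adjacent to the leaves kept from `L`, turns them into an
induced bistar (`exists_bistar_isIndContained`). If its spine is too long for the family, it contains
`P_n`.
-/

namespace GraphFamily

open SimpleGraph

/-! ### Ramsey-type lemmas -/

/-- Ramsey's theorem for two colours, with the bound `2 ^ (p + q)`. -/
theorem exists_isClique_or_isIndepSet {V : Type u} (G : SimpleGraph V) (p q : ℕ)
    (S : Finset V) (hS : 2 ^ (p + q) ≤ S.card) :
    (∃ T ⊆ S, T.card = p ∧ G.IsClique (T : Set V)) ∨
      ∃ T ⊆ S, T.card = q ∧ G.IsIndepSet (T : Set V) := by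
  classical
  induction p generalizing q S with
  | zero => exact Or.inl ⟨∅, by simp⟩
  | succ p ihp =>
    induction q generalizing S with
    | zero => exact Or.inr ⟨∅, by simp⟩
    | succ q ihq =>
      obtain ⟨v, hv⟩ : S.Nonempty := by
        rw [← Finset.card_pos]
        exact lt_of_lt_of_le (by positivity) hS
      have hsplit := Finset.card_filter_add_card_filter_not (s := S.erase v) (G.Adj v)
      rw [Finset.card_erase_of_mem hv] at hsplit
      have hpow : 2 ^ (p + 1 + (q + 1)) = 2 ^ (p + (q + 1)) + 2 ^ (p + 1 + q) := by ring
      have hsub : ∀ (P : V → Prop) [DecidablePred P], (S.erase v).filter P ⊆ S :=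
        fun P _ => (Finset.filter_subset _ _).trans (Finset.erase_subset _ _)
      by_cases hN : 2 ^ (p + (q + 1)) ≤ ((S.erase v).filter (G.Adj v)).card
      · obtain ⟨T, hT, hc, hcl⟩ | ⟨T, hT, h⟩ := ihp (q + 1) _ hN
        · refine Or.inl ⟨insert v T, ?_, ?_, ?_⟩
          · exact Finset.insert_subset hv (hT.trans (hsub _))
          · rw [Finset.card_insert_of_notMem, hc]
            intro hvT
            exact G.irrefl (Finset.mem_filter.1 (hT hvT)).2
          · rw [Finset.coe_insert]
            exact hcl.insert fun b hb _ => (Finset.mem_filter.1 (hT hb)).2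
        · exact Or.inr ⟨T, hT.trans (hsub _), h⟩
      · obtain ⟨T, hT, h⟩ | ⟨T, hT, hc, hi⟩ :=
          ihq ((S.erase v).filter (fun w => ¬ G.Adj v w)) (by omega)
        · exact Or.inl ⟨T, hT.trans (hsub _), h⟩
        · refine Or.inr ⟨insert v T, ?_, ?_, ?_⟩
          · exact Finset.insert_subset hv (hT.trans (hsub _))
          · rw [Finset.card_insert_of_notMem, hc]
            intro hvT
            have := hT hvT
            simp at this
          · rw [Finset.coe_insert, IsIndepSet, Set.pairwise_insert]
            refine ⟨hi, fun b hb _ => ?_⟩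
            have h := (Finset.mem_filter.1 (hT hb)).2
            exact ⟨h, fun h' => h h'.symm⟩

/-- The bipartite Ramsey theorem: two large sets contain subsets of size `n` that are completely
related or completely unrelated. -/
theorem exists_forall_rel_or_forall_not_rel {α β : Type*} (r : α → β → Prop)
    (A : Finset α) (B : Finset β) (n : ℕ) (hA : 2 * n ≤ A.card)
    (hB : n * 2 ^ (2 * n) ≤ B.card) :
    ∃ A' ⊆ A, ∃ B' ⊆ B, A'.card = n ∧ B'.card = n ∧
      ((∀ a ∈ A', ∀ b ∈ B', r a b) ∨ ∀ a ∈ A', ∀ b ∈ B', ¬ r a b) := by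
  classical
  obtain ⟨A₀, hA₀, hcard⟩ := Finset.exists_subset_card_eq hA
  -- Many elements of `B` have the same trace `T` on `A₀`; either `T` or its complement is large.
  obtain ⟨T, hT, hfib⟩ := Finset.exists_le_card_fiber_of_mul_le_card_of_maps_to
    (s := B) (t := A₀.powerset) (n := n) (f := fun b => A₀.filter (fun a => r a b))
    (fun b _ => by simp) ⟨∅, by simp⟩ (by rw [Finset.card_powerset, hcard, mul_comm]; exact hB)
  obtain ⟨B', hB', hB'c⟩ := Finset.exists_subset_card_eq hfib
  have key : ∀ b ∈ B', ∀ a ∈ A₀, (r a b ↔ a ∈ T) := by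
    intro b hb a ha
    have := (Finset.mem_filter.1 (hB' hb)).2
    rw [← this]
    simp [ha]
  have hBB : B' ⊆ B := hB'.trans (Finset.filter_subset _ _)
  rw [Finset.mem_powerset] at hT
  by_cases hTn : n ≤ T.card
  · obtain ⟨A', hA', hA'c⟩ := Finset.exists_subset_card_eq hTn
    exact ⟨A', (hA'.trans hT).trans hA₀, B', hBB, hA'c, hB'c,
      Or.inl fun a ha b hb => (key b hb a (hT (hA' ha))).2 (hA' ha)⟩
  · have hsd : n ≤ (A₀ \ T).card := by
      rw [Finset.card_sdiff_of_subset hT]; omega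
    obtain ⟨A', hA', hA'c⟩ := Finset.exists_subset_card_eq hsd
    refine ⟨A', (hA'.trans Finset.sdiff_subset).trans hA₀, B', hBB, hA'c, hB'c,
      Or.inr fun a ha b hb h => ?_⟩
    have h1 := Finset.mem_sdiff.1 (hA' ha)
    exact h1.2 ((key b hb a h1.1).1 h)

/-- If every element of `B` is related to one of `A`, while no element of `A` is related to more
than `k` elements of `B`, then a large `B` yields an induced matching between `A` and `B`: in a
minimal subset of `A` dominating `B`, every element has a private neighbour. -/
theorem exists_induced_matching {α β : Type*} (r : α → β → Prop)
    (A : Finset α) (B : Finset β) (k n : ℕ) (hdom : ∀ b ∈ B, ∃ a ∈ A, r a b)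
    (hdeg : ∀ a ∈ A, ∀ M ⊆ B, (∀ b ∈ M, r a b) → M.card ≤ k) (hB : k * n < B.card) :
    ∃ (a : Fin n → α) (b : Fin n → β), (∀ i, a i ∈ A) ∧ (∀ i, b i ∈ B) ∧
      ∀ i j, r (a i) (b j) ↔ i = j := by
  classical
  obtain ⟨D, hD, hmin⟩ := Finset.exists_min_image
    (A.powerset.filter fun D => ∀ b ∈ B, ∃ a ∈ D, r a b) Finset.card ⟨A, by simpa using hdom⟩
  simp only [Finset.mem_filter, Finset.mem_powerset] at hD hmin
  obtain ⟨hDA, hDB⟩ := hD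
  have hcard : B.card ≤ D.card * k := by
    have hsub : B ⊆ D.biUnion fun a => B.filter (r a) := by
      intro b hb
      obtain ⟨a, ha, h⟩ := hDB b hb
      exact Finset.mem_biUnion.2 ⟨a, ha, Finset.mem_filter.2 ⟨hb, h⟩⟩
    exact (Finset.card_le_card hsub).trans (Finset.card_biUnion_le_card_mul _ _ _ fun a ha =>
      hdeg a (hDA ha) _ (Finset.filter_subset _ _) fun b hb => (Finset.mem_filter.1 hb).2)
  have hn : n ≤ D.card := by
    by_contra! h
    have : D.card * k ≤ k * n := by rw [mul_comm]; exact Nat.mul_le_mul_left _ h.le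
    omega
  have hpriv : ∀ a ∈ D, ∃ b ∈ B, ∀ a' ∈ D, (r a' b ↔ a' = a) := by
    intro a ha
    by_contra! hcon
    have hlt := hmin (D.erase a) ⟨(Finset.erase_subset _ _).trans hDA, fun b hb => by
      obtain ⟨a', ha', h⟩ := hcon b hb
      obtain ⟨h1, h2⟩ | ⟨h1, rfl⟩ := h
      · exact ⟨a', Finset.mem_erase.2 ⟨h2, ha'⟩, h1⟩
      · obtain ⟨a'', ha'', h''⟩ := hDB b hb
        exact ⟨a'', Finset.mem_erase.2 ⟨fun h => h1 (h ▸ h''), ha''⟩, h''⟩⟩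
    rw [Finset.card_erase_of_mem ha] at hlt
    have := Finset.card_pos.2 ⟨a, ha⟩
    omega
  choose f hfB hf using hpriv
  let e : Fin n → D := fun i => D.equivFin.symm (Fin.castLE hn i)
  have he : Function.Injective e := D.equivFin.symm.injective.comp (Fin.castLE_injective hn)
  refine ⟨fun i => e i, fun i => f (e i) (e i).2, fun i => hDA (e i).2, fun i => hfB _ (e i).2,
    fun i j => ?_⟩
  rw [hf _ (e j).2 _ (e i).2]
  exact ⟨fun h => he (Subtype.ext h), fun h => by rw [h]⟩

/-- A set of at least `n` elements is enumerated, in part, by an injective family. -/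
theorem exists_injective_fin {α : Type*} (S : Finset α) (n : ℕ) (h : n ≤ S.card) :
    ∃ f : Fin n → α, Function.Injective f ∧ ∀ i, f i ∈ S :=
  ⟨fun i => S.equivFin.symm (Fin.castLE h i),
    Subtype.val_injective.comp (S.equivFin.symm.injective.comp (Fin.castLE_injective h)),
    fun i => (S.equivFin.symm (Fin.castLE h i)).2⟩

/-! ### Recognizing the members of the family -/

/-- An injective map that preserves and reflects adjacency exhibits an induced subgraph. -/
theorem isIndContained_of_map {W : Type v} {V : Type u} {H : SimpleGraph W} {G : SimpleGraph V}
    (f : W → V) (hf : ∀ x y, f x = f y → x = y) (hadj : ∀ x y, G.Adj (f x) (f y) ↔ H.Adj x y) :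
    H.IsIndContained G :=
  ⟨⟨⟨f, hf⟩, hadj _ _⟩⟩

theorem starPendant_isIndContained {V : Type u} {G : SimpleGraph V} {n : ℕ} (c : V)
    (a b : Fin n → V) (hca : ∀ i, G.Adj c (a i)) (hcb : ∀ i, ¬ G.Adj c (b i))
    (hne : ∀ i, c ≠ b i) (ha : ∀ i j, ¬ G.Adj (a i) (a j)) (hb : ∀ i j, ¬ G.Adj (b i) (b j))
    (hab : ∀ i j, G.Adj (a i) (b j) ↔ i = j) : (starPendant n).graph.IsIndContained G := by
  have hba : ∀ i j, G.Adj (b i) (a j) ↔ j = i := fun i j => by rw [G.adj_comm, hab]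
  have hac : ∀ i, G.Adj (a i) c := fun i => (hca i).symm
  have hbc : ∀ i, ¬ G.Adj (b i) c := fun i h => hcb i h.symm
  have hneq : ∀ i j, a i ≠ b j := fun i j h => hb j i (h ▸ (hab i i).2 rfl)
  have hai : Function.Injective a := fun i j h => (hab i j).1 (h ▸ (hab j j).2 rfl)
  have hbi : Function.Injective b := fun i j h => (hab i j).1 (h ▸ (hab i i).2 rfl)
  have hne' : ∀ i, c ≠ a i := fun i => (hca i).ne
  change (addPendants (completeBipartiteGraph (Fin 1) (Fin n)) (Set.range Sum.inr)).IsIndContained G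
  refine isIndContained_of_map
    (Sum.elim (Sum.elim (fun _ => c) a) (fun s => Sum.elim (fun _ => c) b s.1)) ?_ ?_
  · rintro ((x | x) | ⟨_, x, rfl⟩) ((y | y) | ⟨_, y, rfl⟩) <;>
      simp [hne, hne', (hne _).symm, (hne' _).symm, hneq, (hneq _ _).symm, hai.eq_iff,
        hbi.eq_iff, eq_iff_true_of_subsingleton]
    rintro rfl
    rfl
  · rintro ((x | x) | ⟨_, x, rfl⟩) ((y | y) | ⟨_, y, rfl⟩) <;>
      simp [addPendants, hca, hcb, hac, hbc, ha, hb, hab, hba]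

theorem completePendant_isIndContained {V : Type u} {G : SimpleGraph V} {n : ℕ}
    (a b : Fin n → V) (ha : ∀ i j, i ≠ j → G.Adj (a i) (a j))
    (hb : ∀ i j, ¬ G.Adj (b i) (b j)) (hab : ∀ i j, G.Adj (a i) (b j) ↔ i = j) :
    (completePendant n).graph.IsIndContained G := by
  have hba : ∀ i j, G.Adj (b i) (a j) ↔ j = i := fun i j => by rw [G.adj_comm, hab]
  have hneq : ∀ i j, a i ≠ b j := fun i j h => hb j i (h ▸ (hab i i).2 rfl)
  have hai : Function.Injective a := fun i j h => (hab i j).1 (h ▸ (hab j j).2 rfl)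
  have hbi : Function.Injective b := fun i j h => (hab i j).1 (h ▸ (hab i i).2 rfl)
  have haa : ∀ i j, G.Adj (a i) (a j) ↔ i ≠ j :=
    fun i j => ⟨fun h e => G.irrefl (e ▸ h), ha i j⟩
  change (addPendants (⊤ : SimpleGraph (Fin n)) Set.univ).IsIndContained G
  refine isIndContained_of_map (Sum.elim a (fun s => b s.1)) ?_ ?_
  · rintro (x | ⟨x, _⟩) (y | ⟨y, _⟩) <;>
      simp [hneq, (hneq _ _).symm, hai.eq_iff, hbi.eq_iff]
  · rintro (x | ⟨x, _⟩) (y | ⟨y, _⟩) <;>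
      simp [addPendants, haa, hba, hab, hb]

theorem completeBipartite_isIndContained {V : Type u} {G : SimpleGraph V} {n : ℕ}
    (a b : Fin n → V) (hai : Function.Injective a) (hbi : Function.Injective b)
    (ha : ∀ i j, ¬ G.Adj (a i) (a j))
    (hb : ∀ i j, ¬ G.Adj (b i) (b j)) (hab : ∀ i j, G.Adj (a i) (b j)) :
    (completeBipartite n).graph.IsIndContained G := by
  have hba : ∀ i j, G.Adj (b i) (a j) := fun i j => (hab j i).symm
  have hneq : ∀ i j, a i ≠ b j := fun i j => (hab i j).ne
  change (completeBipartiteGraph (Fin n) (Fin n)).IsIndContained G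
  refine isIndContained_of_map (Sum.elim a b) ?_ ?_
  · rintro (x | x) (y | y) <;>
      simp [hneq, (hneq _ _).symm, hai.eq_iff, hbi.eq_iff]
  · rintro (x | x) (y | y) <;>
      simp [hab, hba, ha, hb]

theorem path_isIndContained {V : Type u} {G : SimpleGraph V} {n : ℕ} (q : ℕ → V)
    (hqi : ∀ i < n, ∀ j < n, q i = q j → i = j)
    (hq : ∀ i < n, ∀ j < n, (G.Adj (q i) (q j) ↔ i + 1 = j ∨ j + 1 = i)) :
    (path n).graph.IsIndContained G := by
  change (pathGraph n).IsIndContained G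
  exact isIndContained_of_map (fun i : Fin n => q i)
    (fun i j h => Fin.ext (hqi i i.2 j j.2 h))
    fun i j => (hq i i.2 j j.2).trans pathGraph_adj.symm

theorem bistar_isIndContained {V : Type u} {G : SimpleGraph V} {n p : ℕ} (hp : 2 ≤ p)
    (q : ℕ → V) (a b : Fin n → V)
    (hqi : ∀ i < p, ∀ j < p, q i = q j → i = j)
    (hq : ∀ i < p, ∀ j < p, (G.Adj (q i) (q j) ↔ i + 1 = j ∨ j + 1 = i))
    (hai : Function.Injective a) (hbi : Function.Injective b)
    (ha : ∀ i j, ¬ G.Adj (a i) (a j)) (hb : ∀ i j, ¬ G.Adj (b i) (b j))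
    (hab : ∀ i j, ¬ G.Adj (a i) (b j))
    (hqa : ∀ i < p, ∀ j, (G.Adj (q i) (a j) ↔ i = 0))
    (hqb : ∀ i < p, ∀ j, (G.Adj (q i) (b j) ↔ i + 1 = p))
    (hqa' : ∀ i < p, ∀ j, q i ≠ a j) (hqb' : ∀ i < p, ∀ j, q i ≠ b j) :
    (bistar n p).graph.IsIndContained G := by
  have hba : ∀ i j, ¬ G.Adj (b i) (a j) := fun i j h => hab j i h.symm
  have hneq : ∀ i j, a i ≠ b j := by
    intro i j h
    have h1 := (hqa 0 (by omega) i).2 rfl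
    rw [h, hqb 0 (by omega)] at h1
    omega
  have haq : ∀ i < p, ∀ j, (G.Adj (a j) (q i) ↔ i = 0) := fun i hi j => by
    rw [G.adj_comm, hqa i hi]
  have hbq : ∀ i < p, ∀ j, (G.Adj (b j) (q i) ↔ i + 1 = p) := fun i hi j => by
    rw [G.adj_comm, hqb i hi]
  change (bistarGraph n p).IsIndContained G
  refine isIndContained_of_map
    (Sum.elim (fun i : Fin p => q i) (fun s => if s.1 then b s.2 else a s.2)) ?_ ?_
  · rintro (x | ⟨_ | _, x⟩) (y | ⟨_ | _, y⟩) h <;> simp at h ⊢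
    · exact Fin.ext (hqi _ x.2 _ y.2 h)
    · exact hqa' _ x.2 _ h
    · exact hqb' _ x.2 _ h
    · exact hqa' _ y.2 _ h.symm
    · rw [hai h]
    · exact (hneq _ _ h).elim
    · exact hqb' _ y.2 _ h.symm
    · exact (hneq _ _ h.symm).elim
    · rw [hbi h]
  · rintro (x | ⟨_ | _, x⟩) (y | ⟨_ | _, y⟩) <;>
      simp [bistarGraph, hq, hqa, hqb, haq, hbq, ha, hb, hab, hba, pathGraph_adj]

/-- A bistar contains the path through its spine and one leaf on either side. -/
theorem path_isIndContained_bistar {n p : ℕ} (hn : 1 ≤ n) (hnp : n ≤ p + 2) (hp : 1 ≤ p) :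
    (path n).graph.IsIndContained (bistar n p).graph := by
  let q : ℕ → Fin p ⊕ (Bool × Fin n) := fun i =>
    if i = 0 then .inr (false, ⟨0, hn⟩)
    else if h : i - 1 < p then .inl ⟨i - 1, h⟩
    else .inr (true, ⟨0, hn⟩)
  change (path n).graph.IsIndContained (bistarGraph n p)
  refine path_isIndContained q ?_ ?_
  · intro i hi j hj h
    simp only [q] at h
    split_ifs at h <;> simp at h ⊢ <;> omega
  · intro i hi j hj
    simp only [q]
    split_ifs <;> simp [bistarGraph, pathGraph_adj] <;> omega

/-- If `G` contains `BS_n^p`, then it contains a member of the family, namely `BS_n^p` itself or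
`P_n`, according to the length of the spine. -/
theorem exists_mem_saturationFamily_of_bistar {V : Type u} {G : SimpleGraph V} {n p : ℕ}
    (hn : 5 ≤ n) (hp : 2 ≤ p) (h : (bistar n p).graph.IsIndContained G) :
    ∃ F ∈ saturationFamily n, F.graph.IsIndContained G := by
  by_cases hpn : p + 3 ≤ n
  · exact ⟨_, Or.inr ⟨p, hp, hpn, rfl⟩, h⟩
  · exact ⟨path n, Or.inl (by simp),
      (path_isIndContained_bistar (by omega) (by omega) (by omega)).trans h⟩

/-! ### Distance layers -/

theorem dist_le_dist_add_one {V : Type u} {G : SimpleGraph V} (hG : G.Connected) (r : V)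
    {x y : V} (h : G.Adj x y) : G.dist r y ≤ G.dist r x + 1 := by
  have := hG.dist_triangle (u := r) (v := x) (w := y)
  rwa [dist_eq_one_iff_adj.2 h] at this

theorem exists_adj_dist_eq {V : Type u} {G : SimpleGraph V} (hG : G.Connected) {r y : V} {d : ℕ}
    (h : G.dist r y = d + 1) : ∃ x, G.Adj x y ∧ G.dist r x = d := by
  obtain ⟨w, hw⟩ := hG.exists_walk_length_eq_dist y r
  rw [G.dist_comm, h] at hw
  cases w with
  | nil => simp at hw
  | cons hadj w' =>
    rename_i x
    simp only [Walk.length_cons] at hw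
    refine ⟨x, hadj.symm, ?_⟩
    have h1 := dist_le w'
    have h2 := dist_le_dist_add_one hG r hadj.symm
    rw [G.dist_comm] at h1
    omega

/-- A geodesic from `x` to `y`, as a sequence of vertices whose `i`-th term lies at distance `i`
from `x`. -/
theorem exists_geodesic {V : Type u} {G : SimpleGraph V} (hG : G.Connected) (x : V) (d : ℕ)
    (y : V) (h : G.dist x y = d) :
    ∃ p : ℕ → V, p 0 = x ∧ p d = y ∧ (∀ i ≤ d, G.dist x (p i) = i) ∧
      ∀ i < d, G.Adj (p i) (p (i + 1)) := by
  induction d generalizing y with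
  | zero =>
    have := hG.dist_eq_zero_iff.1 h
    subst this
    exact ⟨fun _ => x, rfl, rfl, by simp, by simp⟩
  | succ d ih =>
    obtain ⟨z, hzy, hz⟩ := exists_adj_dist_eq hG h
    obtain ⟨p, h0, hd, hp, hadj⟩ := ih z hz
    refine ⟨fun i => if i ≤ d then p i else y, by simpa, by simp, fun i hi => ?_, fun i hi => ?_⟩
    · by_cases hid : i ≤ d
      · simpa [hid] using hp i hid
      · obtain rfl : i = d + 1 := by omega
        simpa using h
    · by_cases hid : i + 1 ≤ d
      · simpa [hid, show i ≤ d by omega] using hadj i (by omega)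
      · obtain rfl : i = d := by omega
        simpa [hd] using hzy

theorem geodesic_injective {V : Type u} {G : SimpleGraph V} {x : V} {p : ℕ → V} {d : ℕ}
    (hp : ∀ i ≤ d, G.dist x (p i) = i) {i j : ℕ} (hi : i ≤ d) (hj : j ≤ d) (h : p i = p j) :
    i = j := by
  rw [← hp i hi, ← hp j hj, h]

theorem geodesic_adj_iff {V : Type u} {G : SimpleGraph V} (hG : G.Connected) {x : V} {p : ℕ → V}
    {d : ℕ} (hp : ∀ i ≤ d, G.dist x (p i) = i) (hadj : ∀ i < d, G.Adj (p i) (p (i + 1)))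
    {i j : ℕ} (hi : i ≤ d) (hj : j ≤ d) : G.Adj (p i) (p j) ↔ i + 1 = j ∨ j + 1 = i := by
  constructor
  · intro h
    have h1 := dist_le_dist_add_one hG x h
    have h2 := dist_le_dist_add_one hG x h.symm
    rw [hp i hi, hp j hj] at h1 h2
    have : i ≠ j := fun e => G.irrefl (e ▸ h)
    omega
  · rintro (rfl | rfl)
    · exact hadj i (by omega)
    · exact (hadj j (by omega)).symm

theorem dist_lt_of_not_path_isIndContained {V : Type u} {G : SimpleGraph V} {n : ℕ}
    (hG : G.Connected) (hP : ¬ (path n).graph.IsIndContained G) (x y : V) : G.dist x y < n := by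
  by_contra! hn
  obtain ⟨p, -, -, hp, hadj⟩ := exists_geodesic hG x _ y rfl
  exact hP (path_isIndContained p
    (fun i hi j hj h => geodesic_injective hp (by omega) (by omega) h)
    fun i hi j hj => geodesic_adj_iff hG hp hadj (by omega) (by omega))

/-! ### Large stars in large independent sets -/

/-- If `K_n^*` and `K_{1,n}^*` are excluded, a large independent set inside one distance layer has
many elements with a common neighbour in the layer just below. Otherwise the layers below and
above span a large induced matching, whose lower ends form (by Ramsey) a clique, giving `K_n^*`,
or a large independent set with, inductively, a common neighbour of many of its elements, giving
`K_{1,n}^*`. -/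
theorem exists_common_neighbour_of_layer (n d k : ℕ) : ∃ N : ℕ, ∀ (V : Type u) [Finite V]
    (G : SimpleGraph V) (r : V), G.Connected →
    ¬ (completePendant n).graph.IsIndContained G → ¬ (starPendant n).graph.IsIndContained G →
    ∀ S : Finset V, G.IsIndepSet (S : Set V) → (∀ s ∈ S, G.dist r s = d) → N ≤ S.card →
      ∃ y, ∃ M ⊆ S, k ≤ M.card ∧ (∀ m ∈ M, G.Adj y m) ∧ G.dist r y + 1 = d := by
  classical
  induction d generalizing k with
  | zero =>
    refine ⟨2, fun V _ G r hG _ _ S _ hS hc => ?_⟩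
    exfalso
    have : S.card ≤ 1 := Finset.card_le_one.2 fun a ha b hb => by
      rw [← hG.dist_eq_zero_iff.1 (hS a ha), ← hG.dist_eq_zero_iff.1 (hS b hb)]
    omega
  | succ d ih =>
    obtain ⟨N, hN⟩ := ih n
    set K := 2 ^ (n + N) with hK
    refine ⟨k * K + 1, fun V _ G r hG hcp hsp S hS hd hc => ?_⟩
    have := Fintype.ofFinite V
    by_contra hcon
    push Not at hcon
    obtain ⟨a, b, haA, hbS, hab⟩ := exists_induced_matching G.Adj
      (Finset.univ.filter fun v => G.dist r v = d) S k K
      (fun s hs => by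
        obtain ⟨x, hx, hxd⟩ := exists_adj_dist_eq hG (hd s hs)
        exact ⟨x, by simpa using hxd, hx⟩)
      (fun x hx M hM hxM => by
        by_contra! hlt
        exact hcon x M hM hlt.le hxM (by simpa using hx)) (by omega)
    have hbb : ∀ i j, ¬ G.Adj (b i) (b j) :=
      fun i j h => hS (hbS i) (hbS j) h.ne h
    have hai : Function.Injective a := fun i j h => (hab i j).1 (h ▸ (hab j j).2 rfl)
    obtain ⟨T, -, hTc, hT⟩ | ⟨T, -, hTc, hT⟩ := exists_isClique_or_isIndepSet (G.comap a) n N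
      Finset.univ (by simp [hK])
    · obtain ⟨e, he, heT⟩ := exists_injective_fin T n hTc.ge
      refine hcp (completePendant_isIndContained (a ∘ e) (b ∘ e) ?_ (fun i j => hbb _ _) ?_)
      · intro i j hij
        exact hT (heT i) (heT j) (he.ne hij)
      · intro i j
        simp [hab, he.eq_iff]
    · obtain ⟨y, M, hMT, hMc, hyM, hyd⟩ := hN V G r hG hcp hsp (T.image a)
        (by
          intro u hu v hv huv
          obtain ⟨i, hi, rfl⟩ := Finset.mem_image.1 hu
          obtain ⟨j, hj, rfl⟩ := Finset.mem_image.1 hv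
          exact hT hi hj (fun h => huv (h ▸ rfl)))
        (by
          intro u hu
          obtain ⟨i, -, rfl⟩ := Finset.mem_image.1 hu
          simpa using haA i)
        (by rw [Finset.card_image_of_injective _ hai, hTc])
      obtain ⟨m, hm, hmM⟩ := exists_injective_fin M n hMc
      have hidx : ∀ i, ∃ j ∈ T, a j = m i := fun i => Finset.mem_image.1 (hMT (hmM i))
      choose e heT hea using hidx
      have he : Function.Injective e := fun i j h => hm (by rw [← hea, ← hea, h])
      have hfar : ∀ i, G.dist r y + 2 ≤ G.dist r (b i) := fun i => by
        rw [hd _ (hbS i)]; omega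
      refine hsp (starPendant_isIndContained y (a ∘ e) (b ∘ e) ?_ ?_ ?_ ?_ (fun i j => hbb _ _) ?_)
      · intro i
        simpa [hea] using hyM _ (hmM i)
      · intro i h
        have h1 := dist_le_dist_add_one hG r h
        have h2 := hfar (e i)
        simp only [Function.comp] at h1
        omega
      · intro i h
        have h2 := hfar (e i)
        simp only [Function.comp] at h
        rw [← h] at h2
        omega
      · intro i j h
        exact hT (heT i) (heT j) (fun hij => by simp [hij] at h) h
      · intro i j
        simp [hab, he.eq_iff]

/-- Excluding also `P_n` bounds the number of layers, so every large independent set has many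
elements with a common neighbour `y`, all of them one step further than `y` from a given root. -/
theorem exists_common_neighbour (n k : ℕ) : ∃ N : ℕ, ∀ (V : Type u) [Finite V]
    (G : SimpleGraph V) (r : V), G.Connected → ¬ (path n).graph.IsIndContained G →
    ¬ (completePendant n).graph.IsIndContained G → ¬ (starPendant n).graph.IsIndContained G →
    ∀ S : Finset V, G.IsIndepSet (S : Set V) → N ≤ S.card →
      ∃ y, ∃ M ⊆ S, k ≤ M.card ∧ (∀ m ∈ M, G.Adj y m) ∧
        ∀ m ∈ M, G.dist r m = G.dist r y + 1 := by
  classical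
  choose N hN using fun d => exists_common_neighbour_of_layer.{u} n d k
  refine ⟨∑ d ∈ Finset.range n, N d + 1, fun V _ G r hG hP hcp hsp S hS hc => ?_⟩
  obtain ⟨d, -, hd⟩ : ∃ d ∈ Finset.range n, N d < (S.filter fun s => G.dist r s = d).card := by
    refine Finset.exists_lt_of_sum_lt ?_
    rw [← Finset.card_eq_sum_card_fiberwise (f := fun s => G.dist r s)]
    · omega
    · intro s _
      simpa using dist_lt_of_not_path_isIndContained hG hP r s
  obtain ⟨y, M, hM, hMc, hyM, hyd⟩ := hN d V G r hG hcp hsp (S.filter fun s => G.dist r s = d)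
    (fun u hu v hv => hS (Finset.mem_filter.1 hu).1 (Finset.mem_filter.1 hv).1)
    (fun s hs => (Finset.mem_filter.1 hs).2) hd.le
  refine ⟨y, M, hM.trans (Finset.filter_subset _ _), hMc, hyM, fun m hm => ?_⟩
  rw [(Finset.mem_filter.1 (hM hm)).2, hyd]

/-- Follow a sequence `p` from a common neighbour `p 0` of `L`. At each step keep the half of the
current leaf set that is adjacent, or nonadjacent, to the new vertex. In the end the surviving
leaves are adjacent to some `p j` and to no later term up to `p e`. -/
theorem exists_last_common_neighbour {V : Type u} (G : SimpleGraph V) (p : ℕ → V) (L : Finset V)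
    (hL : ∀ l ∈ L, G.Adj (p 0) l) (k e : ℕ) (hc : k * 2 ^ e ≤ L.card) :
    ∃ j ≤ e, ∃ L' ⊆ L, k ≤ L'.card ∧ (∀ l ∈ L', G.Adj (p j) l) ∧
      ∀ i, j < i → i ≤ e → ∀ l ∈ L', ¬ G.Adj (p i) l := by
  classical
  induction e generalizing k with
  | zero => exact ⟨0, le_rfl, L, subset_rfl, by simpa using hc, hL, fun i h1 h2 => by omega⟩
  | succ e ih =>
    obtain ⟨j, hj, L', hL', hc', hadj, hnot⟩ := ih (k * 2) (by rw [mul_assoc, ← pow_succ']; exact hc)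
    have hsplit := Finset.card_filter_add_card_filter_not (s := L') (G.Adj (p (e + 1)))
    by_cases h : k ≤ (L'.filter (G.Adj (p (e + 1)))).card
    · exact ⟨e + 1, le_rfl, _, (Finset.filter_subset _ _).trans hL', h,
        fun l hl => (Finset.mem_filter.1 hl).2, fun i h1 h2 => by omega⟩
    · refine ⟨j, by omega, L'.filter (fun l => ¬ G.Adj (p (e + 1)) l),
        (Finset.filter_subset _ _).trans hL', by omega,
        fun l hl => hadj l (Finset.mem_filter.1 hl).1, fun i h1 h2 l hl => ?_⟩
      rcases Nat.lt_or_ge i (e + 1) with h3 | h3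
      · exact hnot i h1 (by omega) l (Finset.mem_filter.1 hl).1
      · obtain rfl : i = e + 1 := by omega
        exact (Finset.mem_filter.1 hl).2

/-! ### Bistars from a pair of stars -/

/-- Two stars, with centres `x` and `y`, whose leaf sets `L` and `M` see neither each other nor
the opposite centre, span a bistar, provided that `M` lies one step further from `x` than `y`.
Its spine is the end segment of a geodesic from `x` to `y` starting at the last vertex that is
adjacent to many of the leaves in `L`. -/
theorem exists_bistar_isIndContained {V : Type u} {G : SimpleGraph V} (hG : G.Connected)
    {n : ℕ} (hn : 1 ≤ n) {x y : V} (hxy : G.dist x y ≤ n) {L M : Finset V}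
    (hL : G.IsIndepSet (L : Set V)) (hM : G.IsIndepSet (M : Set V))
    (hxL : ∀ l ∈ L, G.Adj x l) (hyM : ∀ m ∈ M, G.Adj y m)
    (hyL : ∀ l ∈ L, ¬ G.Adj y l) (hLM : ∀ l ∈ L, ∀ m ∈ M, ¬ G.Adj l m)
    (hMd : ∀ m ∈ M, G.dist x m = G.dist x y + 1)
    (hLc : n * 2 ^ n + 1 ≤ L.card) (hMc : n ≤ M.card) :
    ∃ p, 2 ≤ p ∧ (bistar n p).graph.IsIndContained G := by
  classical
  obtain ⟨d, hd⟩ : ∃ d, G.dist x y = d := ⟨_, rfl⟩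
  obtain ⟨p, hp0, hpd, hp, hadj⟩ := exists_geodesic hG x d y hd
  -- `p 1` may be one of the leaves in `L`; no other vertex of the geodesic is.
  have hcard : n * 2 ^ d ≤ (L.erase (p 1)).card := by
    have h1 : n * 2 ^ d ≤ n * 2 ^ n :=
      Nat.mul_le_mul_left _ (Nat.pow_le_pow_right (by norm_num) (hd ▸ hxy))
    have h2 := Finset.pred_card_le_card_erase (s := L) (a := p 1)
    omega
  obtain ⟨j, hj, L', hL', hL'c, hjL, hnot⟩ := exists_last_common_neighbour G p (L.erase (p 1))
    (fun l hl => hp0 ▸ hxL l (Finset.mem_of_mem_erase hl)) n d hcard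
  have hL'L : ∀ l ∈ L', l ∈ L := fun l hl => Finset.mem_of_mem_erase (hL' hl)
  have hjd : j ≠ d := by
    rintro rfl
    obtain ⟨l, hl⟩ : L'.Nonempty := Finset.card_pos.1 (by omega)
    exact hyL l (hL'L l hl) (hpd ▸ hjL l hl)
  obtain ⟨a, hai, haL⟩ := exists_injective_fin L' n hL'c
  obtain ⟨b, hbi, hbM⟩ := exists_injective_fin M n hMc
  refine ⟨d - j + 1, by omega, bistar_isIndContained (by omega) (fun i => p (j + i)) a b
    ?_ ?_ hai hbi ?_ ?_ ?_ ?_ ?_ ?_ ?_⟩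
  · intro i hi i' hi' h
    have := geodesic_injective hp (by omega) (by omega) h
    omega
  · intro i hi i' hi'
    rw [geodesic_adj_iff hG hp hadj (by omega) (by omega)]
    omega
  · exact fun i i' h => hL (hL'L _ (haL i)) (hL'L _ (haL i')) h.ne h
  · exact fun i i' h => hM (hbM i) (hbM i') h.ne h
  · exact fun i i' => hLM _ (hL'L _ (haL i)) _ (hbM i')
  · intro i hi i'
    constructor
    · intro h
      by_contra h0
      exact hnot (j + i) (by omega) (by omega) _ (haL i') h
    · rintro rfl
      exact hjL _ (haL i')
  · intro i hi i'
    constructor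
    · intro h
      have h1 := dist_le_dist_add_one hG x h
      rw [hMd _ (hbM i'), hp _ (by omega)] at h1
      omega
    · intro h
      rw [show j + i = d by omega, hpd]
      exact hyM _ (hbM i')
  · intro i hi i' h
    have h1 : G.dist x (a i') = 1 := dist_eq_one_iff_adj.2 (hxL _ (hL'L _ (haL i')))
    have h2 := hp (j + i) (by omega)
    rw [h, h1] at h2
    exact Finset.ne_of_mem_erase (hL' (haL i')) (by rw [← h, ← h2])
  · intro i hi i' h
    have h1 := hMd _ (hbM i')
    rw [← h, hp _ (by omega)] at h1
    omega

/-- An independent set `S` avoiding the closed neighbourhood of the centre `x` of a star with leaf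
set `L` has few vertices with a neighbour in `L`: a leaf with many neighbours in `S` gives `K_{n,n}`
or `BS_n^2`, and otherwise an induced matching between `L` and `S` gives `K_{1,n}^*`. -/
theorem card_filter_exists_adj_le {V : Type u} {G : SimpleGraph V} [DecidableEq V] {n : ℕ}
    (hK : ¬ (completeBipartite n).graph.IsIndContained G)
    (hB : ¬ (bistar n 2).graph.IsIndContained G)
    (hsp : ¬ (starPendant n).graph.IsIndContained G) {x : V} {L S : Finset V}
    (hL : G.IsIndepSet (L : Set V)) (hS : G.IsIndepSet (S : Set V))
    (hxL : ∀ l ∈ L, G.Adj x l) (hxS : ∀ s ∈ S, ¬ G.Adj x s) (hx : x ∉ S)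
    (hLc : 2 * n + 1 ≤ L.card) [DecidablePred fun s => ∃ l ∈ L, G.Adj l s] :
    (S.filter fun s => ∃ l ∈ L, G.Adj l s).card ≤ n * 2 ^ (2 * n) * n := by
  classical
  by_contra! hlt
  have hSS : ∀ i ∈ S, ∀ j ∈ S, ¬ G.Adj i j := fun i hi j hj h => hS hi hj h.ne h
  have hLL : ∀ i ∈ L, ∀ j ∈ L, ¬ G.Adj i j := fun i hi j hj h => hL hi hj h.ne h
  obtain ⟨a, b, haL, hbS, hab⟩ := exists_induced_matching G.Adj L _ _ n
    (fun s hs => (Finset.mem_filter.1 hs).2)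
    (fun l hl M hM hlM => by
      by_contra! hMc
      have hMS : M ⊆ S := hM.trans (Finset.filter_subset _ _)
      obtain ⟨A, hA, B, hBM, hAc, hBc, h⟩ := exists_forall_rel_or_forall_not_rel G.Adj
        (L.erase l) M n (by rw [Finset.card_erase_of_mem hl]; omega) hMc.le
      obtain ⟨a, hai, ha⟩ := exists_injective_fin A n hAc.ge
      obtain ⟨b, hbi, hb⟩ := exists_injective_fin B n hBc.ge
      have haL : ∀ i, a i ∈ L := fun i => Finset.mem_of_mem_erase (hA (ha i))
      have hal : ∀ i, l ≠ a i := fun i => (Finset.ne_of_mem_erase (hA (ha i))).symm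
      have hbS : ∀ i, b i ∈ S := fun i => hMS (hBM (hb i))
      have haa : ∀ i j, ¬ G.Adj (a i) (a j) := fun i j => hLL _ (haL i) _ (haL j)
      have hbb : ∀ i j, ¬ G.Adj (b i) (b j) := fun i j => hSS _ (hbS i) _ (hbS j)
      rcases h with h | h
      · exact hK (completeBipartite_isIndContained a b hai hbi haa hbb
          fun i j => h _ (ha i) _ (hb j))
      · have hxl := hxL l hl
        refine hB (bistar_isIndContained le_rfl (fun i => if i = 0 then x else l) a b
          ?_ ?_ hai hbi haa hbb (fun i j => h _ (ha i) _ (hb j)) ?_ ?_ ?_ ?_)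
        · intro i hi j hj
          interval_cases i <;> interval_cases j <;> simp [hxl.ne, hxl.ne.symm]
        · intro i hi j hj
          interval_cases i <;> interval_cases j <;> simp [hxl, hxl.symm]
        · intro i hi j
          interval_cases i
          · simpa using hxL _ (haL j)
          · simpa using hLL _ hl _ (haL j)
        · intro i hi j
          interval_cases i
          · simpa using hxS _ (hbS j)
          · simpa using hlM _ (hBM (hb j))
        · intro i hi j
          interval_cases i
          · simpa using (hxL _ (haL j)).ne
          · simpa using hal j
        · intro i hi j
          interval_cases i
          · simpa using fun h' : x = b j => hx (h' ▸ hbS j)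
          · simpa using (hlM _ (hBM (hb j))).ne) hlt
  have hbS' : ∀ i, b i ∈ S := fun i => (Finset.mem_filter.1 (hbS i)).1
  exact hsp (starPendant_isIndContained x a b (fun i => hxL _ (haL i)) (fun i => hxS _ (hbS' i))
    (fun i h => hx (h ▸ hbS' i)) (fun i j => hLL _ (haL i) _ (haL j))
    (fun i j => hSS _ (hbS' i) _ (hbS' j)) hab)

/-! ### The bound on the independence saturation number -/

/-- In a connected graph without members of `saturationFamily n`, some vertex, namely the centre of
a largest induced star, lies in no large independent set. -/
theorem exists_vertex_indepSet_card_lt (n : ℕ) (hn : 5 ≤ n) : ∃ c : ℕ, ∀ (V : Type u) [Finite V]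
    (G : SimpleGraph V), G.Connected →
    (∀ F ∈ saturationFamily n, ¬ F.graph.IsIndContained G) →
    ∃ x : V, ∀ S : Finset V, G.IsIndepSet (S : Set V) → x ∈ S → S.card < c := by
  classical
  -- `m` is the number of leaves that the two stars of a bistar should have before trimming.
  obtain ⟨m, hm⟩ : ∃ m, m = n * 2 ^ n + 1 := ⟨_, rfl⟩
  obtain ⟨N, hN⟩ := exists_common_neighbour.{u} n m
  refine ⟨N + n * 2 ^ (2 * n) * n + 1, fun V _ G hG hfree => ?_⟩
  have := Fintype.ofFinite V
  have hm2 : 2 * n + 1 ≤ m := by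
    have : 2 ≤ 2 ^ n := by
      calc 2 = 2 ^ 1 := rfl
        _ ≤ 2 ^ n := Nat.pow_le_pow_right (by norm_num) (by omega)
    have := Nat.mul_le_mul_left n this
    omega
  have hsp := hfree (starPendant n) (Or.inl (by simp))
  have hcp := hfree (completePendant n) (Or.inl (by simp))
  have hP := hfree (path n) (Or.inl (by simp))
  have hK := hfree (completeBipartite n) (Or.inl (by simp))
  have hB := hfree (bistar n 2) (Or.inr ⟨2, le_rfl, by omega, rfl⟩)
  by_contra! hbig
  obtain ⟨r⟩ := hG.nonempty
  -- A largest induced star, with centre `x` and leaf set `L`.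
  obtain ⟨⟨x, L⟩, hxL, hmax⟩ := Finset.exists_max_image
    (Finset.univ.filter fun t : V × Finset V =>
      G.IsIndepSet (t.2 : Set V) ∧ ∀ l ∈ t.2, G.Adj t.1 l) (fun t => t.2.card)
    ⟨(r, ∅), by simp⟩
  simp only [Finset.mem_filter, Finset.mem_univ, true_and, Prod.forall] at hxL hmax
  obtain ⟨hL, hxL⟩ := hxL
  have hLm : m ≤ L.card := by
    obtain ⟨S, hS, -, hSc⟩ := hbig r
    obtain ⟨y, M, hM, hMc, hyM, -⟩ := hN V G r hG hP hcp hsp S hS (by omega)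
    exact hMc.trans (hmax y M ⟨fun u hu v hv => hS (hM hu) (hM hv), hyM⟩)
  obtain ⟨S, hS, hxS, hSc⟩ := hbig x
  have hxS' : ∀ s ∈ S.erase x, ¬ G.Adj x s := fun s hs h =>
    hS hxS (Finset.mem_of_mem_erase hs) h.ne h
  have hS' : G.IsIndepSet (S.erase x : Finset V) := fun u hu v hv =>
    hS (Finset.mem_of_mem_erase hu) (Finset.mem_of_mem_erase hv)
  have hdom := card_filter_exists_adj_le hK hB hsp hL hS' hxL hxS' (Finset.notMem_erase x S)
    (hm2.trans hLm)
  have hsplit := Finset.card_filter_add_card_filter_not (s := S.erase x)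
    (fun s => ∃ l ∈ L, G.Adj l s)
  rw [Finset.card_erase_of_mem hxS] at hsplit
  obtain ⟨y, M, hM, hMc, hyM, hMd⟩ := hN V G x hG hP hcp hsp
    ((S.erase x).filter fun s => ¬ ∃ l ∈ L, G.Adj l s)
    (fun u hu v hv => hS' (Finset.mem_filter.1 hu).1 (Finset.mem_filter.1 hv).1) (by omega)
  have hMi : G.IsIndepSet (M : Set V) := fun u hu v hv =>
    hS' (Finset.mem_filter.1 (hM hu)).1 (Finset.mem_filter.1 (hM hv)).1
  have hLM : ∀ l ∈ L, ∀ m ∈ M, ¬ G.Adj l m := fun l hl m hm h =>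
    (Finset.mem_filter.1 (hM hm)).2 ⟨l, hl, h⟩
  have hxM : ∀ m ∈ M, ¬ G.Adj x m := fun m hm => hxS' m (Finset.mem_filter.1 (hM hm)).1
  -- By maximality, `y` misses many elements of `L`: its neighbours there and `M` form a star.
  have hmiss : m ≤ (L.filter fun l => ¬ G.Adj y l).card := by
    have hsplitL := Finset.card_filter_add_card_filter_not (s := L) (G.Adj y)
    have hdisj : Disjoint (L.filter (G.Adj y)) M := Finset.disjoint_left.2 fun l hl hlM =>
      hxM l hlM (hxL l (Finset.mem_filter.1 hl).1)
    have hstar := hmax y (L.filter (G.Adj y) ∪ M) ⟨by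
      intro u hu v hv huv
      simp only [Finset.coe_union, Set.mem_union, Finset.mem_coe, Finset.mem_filter] at hu hv
      rcases hu with hu | hu <;> rcases hv with hv | hv
      · exact hL hu.1 hv.1 huv
      · exact hLM u hu.1 v hv
      · exact fun h => hLM v hv.1 u hu h.symm
      · exact hMi hu hv huv, by
      intro l hl
      rcases Finset.mem_union.1 hl with h | h
      · exact (Finset.mem_filter.1 h).2
      · exact hyM l h⟩
    rw [Finset.card_union_of_disjoint hdisj] at hstar
    omega
  obtain ⟨p, hp, hpG⟩ := exists_bistar_isIndContained hG (by omega : 1 ≤ n)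
    (dist_lt_of_not_path_isIndContained hG hP x y).le
    (L := L.filter fun l => ¬ G.Adj y l) (M := M)
    (fun u hu v hv => hL (Finset.mem_filter.1 hu).1 (Finset.mem_filter.1 hv).1) hMi
    (fun l hl => hxL l (Finset.mem_filter.1 hl).1) hyM (fun l hl => (Finset.mem_filter.1 hl).2)
    (fun l hl => hLM l (Finset.mem_filter.1 hl).1) hMd (by omega) (by omega)
  obtain ⟨F, hF, hFG⟩ := exists_mem_saturationFamily_of_bistar hn hp hpG
  exact hfree F hF hFG

/-! ### The members of the family have large independence saturation number -/

theorem card_le_vertexIS {G : FinGraph.{u}} {x : G.V} {S : Finset G.V}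
    (hS : G.graph.IsIndepSet (S : Set G.V)) (hx : x ∈ S) : S.card ≤ vertexIS G x := by
  have := Fintype.ofFinite G.V
  refine le_csSup ⟨Fintype.card G.V, ?_⟩ ⟨S, hS, hx, rfl⟩
  rintro k ⟨T, -, -, rfl⟩
  exact T.card_le_univ

theorem independenceSaturation_lt {G : FinGraph.{u}} {c : ℕ} (x : G.V)
    (h : ∀ S : Finset G.V, G.graph.IsIndepSet (S : Set G.V) → x ∈ S → S.card < c) :
    independenceSaturation G < c := by
  refine lt_of_le_of_lt (ciInf_le (OrderBot.bddBelow _) x) ?_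
  have hne : {k | ∃ S : Finset G.V, G.graph.IsIndepSet (S : Set G.V) ∧ x ∈ S ∧ S.card = k}.Nonempty :=
    ⟨1, {x}, by simp, by simp, by simp⟩
  have hbdd : BddAbove
      {k | ∃ S : Finset G.V, G.graph.IsIndepSet (S : Set G.V) ∧ x ∈ S ∧ S.card = k} := by
    refine ⟨c, ?_⟩
    rintro k ⟨T, hT, hx, rfl⟩
    exact (h T hT hx).le
  obtain ⟨S, hS, hx, hc⟩ := Nat.sSup_mem hne hbdd
  unfold vertexIS
  rw [← hc]
  exact h S hS hx

/-- Every vertex of `G` is nonadjacent to all members of some independent family of `c` distinct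
vertices. The vertex itself may belong to the family. -/
def HasIndependentFamilies {V : Type u} (G : SimpleGraph V) (c : ℕ) : Prop :=
  ∀ x : V, ∃ f : Fin c → V, Function.Injective f ∧ (∀ i j, ¬ G.Adj (f i) (f j)) ∧
    ∀ i, ¬ G.Adj x (f i)

theorem le_independenceSaturation {G : FinGraph.{u}} {c : ℕ} (hne : Nonempty G.V)
    (h : HasIndependentFamilies G.graph c) : c ≤ independenceSaturation G := by
  classical
  refine le_ciInf fun x => ?_
  obtain ⟨f, hf, hff, hxf⟩ := h x
  have hS : G.graph.IsIndepSet ((insert x (Finset.univ.image f) : Finset G.V) : Set G.V) := by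
    rw [Finset.coe_insert, IsIndepSet, Set.pairwise_insert]
    refine ⟨?_, ?_⟩
    · rintro u hu v hv -
      obtain ⟨i, -, rfl⟩ := Finset.mem_image.1 hu
      obtain ⟨j, -, rfl⟩ := Finset.mem_image.1 hv
      exact hff i j
    · rintro v hv -
      obtain ⟨i, -, rfl⟩ := Finset.mem_image.1 hv
      exact ⟨hxf i, fun h => hxf i h.symm⟩
  refine le_trans ?_ (card_le_vertexIS hS (Finset.mem_insert_self _ _))
  refine le_trans ?_ (Finset.card_le_card (Finset.subset_insert _ _))
  rw [Finset.card_image_of_injective _ hf, Finset.card_univ, Fintype.card_fin]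

theorem addPendants_connected {V : Type u} {G : SimpleGraph V} (hG : G.Connected) (S : Set V) :
    (addPendants G S).Connected := by
  obtain ⟨r⟩ := hG.nonempty
  let φ : G →g addPendants G S := ⟨Sum.inl, fun h => h⟩
  rw [connected_iff_exists_forall_reachable]
  have hinl : ∀ v, (addPendants G S).Reachable (.inl r) (.inl v) :=
    fun v => (hG.preconnected r v).map φ
  refine ⟨.inl r, ?_⟩
  rintro (v | s)
  · exact hinl v
  · exact (hinl s).trans (Adj.reachable (show (s : V) = s from rfl))

theorem hasIndependentFamilies_addPendants {V : Type u} (G : SimpleGraph V) (S : Set V) {c : ℕ}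
    (g : Fin (c + 1) → S) (hg : Function.Injective g) :
    HasIndependentFamilies (addPendants G S) c := by
  rintro (v | s)
  · by_cases h : ∃ j, (g j : V) = v
    · obtain ⟨j, rfl⟩ := h
      refine ⟨fun i => .inr (g (j.succAbove i)),
        Sum.inr_injective.comp (hg.comp Fin.succAbove_right_injective), fun _ _ h => h, ?_⟩
      intro i h
      exact Fin.succAbove_ne j i (hg (Subtype.ext h)).symm
    · push Not at h
      exact ⟨fun i => .inr (g i.castSucc),
        Sum.inr_injective.comp (hg.comp (Fin.castSucc_injective c)), fun _ _ h => h,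
        fun i h' => h _ (Eq.symm h')⟩
  · exact ⟨fun i => .inr (g i.castSucc),
      Sum.inr_injective.comp (hg.comp (Fin.castSucc_injective c)), fun _ _ h => h, fun _ h => h⟩

theorem completeBipartiteGraph_connected {α β : Type*} (a : α) (b : β) :
    (completeBipartiteGraph α β).Connected := by
  rw [connected_iff_exists_forall_reachable]
  refine ⟨.inl a, ?_⟩
  have hb : ∀ y, (completeBipartiteGraph α β).Reachable (.inl a) (.inr y) :=
    fun y => Adj.reachable (by simp)
  rintro (x | y)
  · exact (hb b).trans (Adj.reachable (by simp))
  · exact hb y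

theorem starPendant_connected {n : ℕ} (hn : 1 ≤ n) : (starPendant n).graph.Connected :=
  addPendants_connected (completeBipartiteGraph_connected 0 ⟨0, hn⟩) _

theorem hasIndependentFamilies_starPendant {n c : ℕ} (h : c + 1 ≤ n) :
    HasIndependentFamilies (starPendant n).graph c :=
  hasIndependentFamilies_addPendants _ _ (fun i => ⟨.inr (Fin.castLE h i), _, rfl⟩)
    fun _ _ hij => Fin.castLE_injective h (Sum.inr_injective (congrArg Subtype.val hij))

theorem completePendant_connected {n : ℕ} (hn : 1 ≤ n) : (completePendant n).graph.Connected :=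
  have : Nonempty (Fin n) := ⟨⟨0, hn⟩⟩
  addPendants_connected connected_top _

theorem hasIndependentFamilies_completePendant {n c : ℕ} (h : c + 1 ≤ n) :
    HasIndependentFamilies (completePendant n).graph c :=
  hasIndependentFamilies_addPendants _ _ (fun i => ⟨Fin.castLE h i, trivial⟩)
    fun _ _ hij => Fin.castLE_injective h (congrArg Subtype.val hij)

theorem hasIndependentFamilies_path {n c : ℕ} (h : 2 * c + 1 ≤ n) :
    HasIndependentFamilies (path n).graph c := by
  change HasIndependentFamilies (pathGraph n) c
  -- The family consists of vertices of the same parity as `x`.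
  intro x
  refine ⟨fun i => ⟨2 * i + x % 2, by omega⟩, fun i j hij => ?_, fun i j => ?_, fun i => ?_⟩
  · rw [Fin.mk.injEq] at hij
    omega
  · rw [pathGraph_adj]
    dsimp only
    omega
  · rw [pathGraph_adj]
    dsimp only
    omega

theorem hasIndependentFamilies_completeBipartite {n c : ℕ} (h : c ≤ n) :
    HasIndependentFamilies (completeBipartite n).graph c := by
  change HasIndependentFamilies (completeBipartiteGraph (Fin n) (Fin n)) c
  rintro (x | x)
  · exact ⟨fun i => .inl (Fin.castLE h i), fun i j hij => by simpa using hij, by simp, by simp⟩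
  · exact ⟨fun i => .inr (Fin.castLE h i), fun i j hij => by simpa using hij, by simp, by simp⟩

theorem bistar_connected {n p : ℕ} (hp : 1 ≤ p) : (bistar n p).graph.Connected := by
  change (bistarGraph n p).Connected
  let φ : pathGraph p →g bistarGraph n p := ⟨Sum.inl, fun h => h⟩
  have hinl : ∀ v, (bistarGraph n p).Reachable (.inl ⟨0, hp⟩) (.inl v) :=
    fun v => ((pathGraph_preconnected p) _ v).map φ
  rw [connected_iff_exists_forall_reachable]
  refine ⟨.inl ⟨0, hp⟩, ?_⟩
  rintro (v | ⟨_ | _, i⟩)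
  · exact hinl v
  · exact Adj.reachable (by simp [bistarGraph])
  · exact (hinl ⟨p - 1, by omega⟩).trans (Adj.reachable (by simp [bistarGraph]; omega))

theorem hasIndependentFamilies_bistar {n p c : ℕ} (hp : 2 ≤ p) (h : c ≤ n) :
    HasIndependentFamilies (bistar n p).graph c := by
  change HasIndependentFamilies (bistarGraph n p) c
  have key : ∀ (e : Bool) (x), (∀ k, ¬ (bistarGraph n p).Adj x (.inr (e, k))) →
      ∃ f : Fin c → Fin p ⊕ (Bool × Fin n), Function.Injective f ∧
        (∀ i j, ¬ (bistarGraph n p).Adj (f i) (f j)) ∧ ∀ i, ¬ (bistarGraph n p).Adj x (f i) :=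
    fun e x hx => ⟨fun i => .inr (e, Fin.castLE h i), fun i j hij => by simpa using hij,
      fun i j => by simp [bistarGraph], fun i => hx _⟩
  rintro (x | x)
  · by_cases hx : (x : ℕ) = 0
    · exact key true _ fun k => by simp [bistarGraph]; omega
    · exact key false _ fun k => by simpa [bistarGraph] using hx
  · exact key true _ fun k => by simp [bistarGraph]

theorem connected_and_hasIndependentFamilies {n c : ℕ} (h : 2 * c + 1 ≤ n) {F : FinGraph.{0}}
    (hF : F ∈ saturationFamily n) : F.graph.Connected ∧ HasIndependentFamilies F.graph c := by
  rcases hF with hF | ⟨p, hp, -, rfl⟩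
  · simp only [Set.mem_insert_iff, Set.mem_singleton_iff] at hF
    rcases hF with rfl | rfl | rfl | rfl
    · exact ⟨starPendant_connected (by omega), hasIndependentFamilies_starPendant (by omega)⟩
    · exact ⟨completePendant_connected (by omega), hasIndependentFamilies_completePendant (by omega)⟩
    · obtain ⟨k, rfl⟩ : ∃ k, n = k + 1 := ⟨n - 1, by omega⟩
      exact ⟨pathGraph_connected k, hasIndependentFamilies_path h⟩
    · exact ⟨completeBipartiteGraph_connected ⟨0, by omega⟩ ⟨0, by omega⟩,
        hasIndependentFamilies_completeBipartite (by omega)⟩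
  · exact ⟨bistar_connected (by omega), hasIndependentFamilies_bistar hp (by omega)⟩

/-- A copy of a finite graph on a vertex type in a larger universe. -/
def FinGraph.lift (F : FinGraph.{0}) : FinGraph.{u} where
  V := ULift.{u} F.V
  graph := F.graph.comap ULift.down

/-- The projection from the lifted graph to the original one. -/
def FinGraph.liftIso (F : FinGraph.{0}) : F.lift.graph ≃g F.graph where
  toEquiv := Equiv.ulift
  map_rel_iff' := Iff.rfl

theorem HasIndependentFamilies.of_iso {V : Type u} {W : Type v} {G : SimpleGraph V}
    {H : SimpleGraph W} {c : ℕ} (h : HasIndependentFamilies H c) (e : G ≃g H) :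
    HasIndependentFamilies G c := by
  intro x
  obtain ⟨f, hf, hff, hxf⟩ := h (e x)
  refine ⟨e.symm ∘ f, e.symm.injective.comp hf, fun i j => ?_, fun i => ?_⟩
  · rw [← e.map_adj_iff]
    simpa using hff i j
  · rw [← e.map_adj_iff]
    simpa using hxf i

end GraphFamily

theorem mainTheorem3 (ℋ : Set GraphFamily.FinGraph.{u}) :
    ℋ ∈ GraphFamily.BoundedFamilies GraphFamily.independenceSaturation ↔
      ∃ n : ℕ, 5 ≤ n ∧ GraphFamily.FamilyLE ℋ (GraphFamily.saturationFamily n) := by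
  constructor
  · rintro ⟨c, hc⟩
    refine ⟨2 * c + 5, by omega, fun F hF => ?_⟩
    by_contra! hnone
    obtain ⟨hconn, hind⟩ := GraphFamily.connected_and_hasIndependentFamilies (c := c) (by omega) hF
    have hconn' : F.lift.graph.Connected := F.liftIso.connected_iff.2 hconn
    have hlt := hc F.lift hconn' fun H hH hHF =>
      hnone H hH (hHF.trans ⟨F.liftIso.toEmbedding⟩)
    have hle := GraphFamily.le_independenceSaturation hconn'.nonempty (hind.of_iso F.liftIso)
    omega
  · rintro ⟨n, hn, hle⟩
    obtain ⟨c, hc⟩ := GraphFamily.exists_vertex_indepSet_card_lt.{u} n hn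
    refine ⟨c, fun G hG hfree => ?_⟩
    obtain ⟨x, hx⟩ := hc G.V G.graph hG fun F hF hFG => by
      obtain ⟨H, hH, hHF⟩ := hle F hF
      exact hfree H hH (hHF.trans hFG)
    exact GraphFamily.independenceSaturation_lt x hx
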